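/- Theorem (Utility guarantee of DP-GSD, $k=1$). Let $p\ge 2$, let $L(w,z)$ be a loss function with parameters $w\in\mathbb{R}^p$, let $w_0\in\mathbb{R}^p$, and let $x^{priv}_1,\dots,x^{priv}_m$ and $x^{pub}_1,\dots,x^{pub}_n$ be private and public examples at which $w\mapsto L(w,x)$ is differentiable at $w_0$. Let $G_{pub}\in\mathbb{R}^{n\times p}$ be the matrix with rows $\nabla_w L(w_0,x^{pub}_i)$. Fix a clip norm $c>0$, and let $G\in\mathbb{R}^{m\times p}$ be the clipped private gradient matrix, with rows $\min(1,c/\|g_i\|)\,g_i$, where $g_i=\nabla_w L(w_0,x^{priv}_i)$ (so $G$ is the private gradient matrix itself if $\|g_i\|\le c$ for all $i$). Put $A=\frac1m G^\top G$, let $\lambda_1\ge\lambda_2\ge\dots\ge\lambda_p$ be the eigenvalues of $A$, and suppose that the eigengap $\alpha=\lambda_1-\lambda_2$ is positive. For orthonormal $V_1,V_2\in\mathbb{R}^{p\times k}$ with principal angles $\theta_1,\dots,\theta_k$ between their column spans, let $d(V_1,V_2)=(\sum_{i=1}^k\sin^2\theta_i)^{1/2}$ be the projection metric. Let $V^{priv}$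 and $V^{pub}$ be top ($k=1$) right singular vectors of $G$ and of $G_{pub}$, taken from any singular value decompositions. The non-private gradient subspace distance (GSD) is $d(V^{priv},V^{pub})$. For a privacy parameter $\varepsilon'>0$, let DPPCA$(G,\varepsilon')$ be the Bingham mechanism, which outputs a random unit vector $\hat V\in\mathbb{R}^p$ with density proportional to $\exp\!\big(\operatorname{tr}(\hat V^\top \tfrac{m\varepsilon'}{2}A\,\hat V)\big)$ with respect to the uniform distribution on the unit sphere; the DP-GSD distance is $d(\hat V,V^{pub})$. Let $\varepsilon>0$, $0<\rho\le 1$, $\eta>0$, and suppose that $$m>\frac{pc^2}{\varepsilon\alpha\,(1-\sqrt{1-\rho^2})}\left(4\,\frac{\log(1/\eta)}{p}+2\log\frac{8\lambda_1}{\rho^2\alpha}\right).$$ If $\hat V$ is sampled by DPPCA$(G,\varepsilon/c^2)$, that is, from the Bingham distribution with parameter $\frac{m\varepsilon}{2c^2}A$, then the DP-GSD distance is $(\rho,\eta)$-close to the GSD: $$\Pr\big[\,|d(\hat V,V^{pub})-d(V^{priv},V^{pub})|\le\rho\,\big]\ge 1-\eta .$$ If $c\ge 1$, the same holds when $\hat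 V$ is sampled by DPPCA$(G,\varepsilon)$, that is, from the Bingham distribution with parameter $\frac{m\varepsilon}{2}A$. -/

import Mathlib

open MeasureTheory ProbabilityTheory

noncomputable section

/-! ### Projection metric -/

/-- `θ` are the principal angles between the subspaces `S` and `T`, with principal vectors `u`, `v`:
at stage `i` the pair `(u i, v i)` maximizes `⟪x, y⟫` over the unit vectors `x ∈ S`, `y ∈ T` that are
orthogonal to the previously chosen ones, and `cos (θ i)` is that maximum. -/
def IsPrincipalAngles {E : Type*} [NormedAddCommGroup E] [InnerProductSpace ℝ E]
    (S T : Submodule ℝ E) {k : ℕ} (θ : Fin k → ℝ) : Prop :=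
  ∃ u v : Fin k → E, ∀ i : Fin k,
    (u i ∈ S ∧ v i ∈ T ∧ ‖u i‖ = 1 ∧ ‖v i‖ = 1 ∧
      ∀ j < i, inner ℝ (u i) (u j) = 0 ∧ inner ℝ (v i) (v j) = 0) ∧
    (∀ x ∈ S, ∀ y ∈ T, ‖x‖ = 1 → ‖y‖ = 1 →
      (∀ j < i, inner ℝ x (u j) = 0 ∧ inner ℝ y (v j) = 0) →
        inner ℝ x y ≤ inner ℝ (u i) (v i)) ∧
    0 ≤ θ i ∧ θ i ≤ Real.pi / 2 ∧ Real.cos (θ i) = inner ℝ (u i) (v i)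

/-- The principal angles between the spans of two families of `k` vectors (for orthonormal families
they exist, and they do not depend on the choice of the principal vectors). -/
def principalAngles {E : Type*} [NormedAddCommGroup E] [InnerProductSpace ℝ E] {k : ℕ}
    (V₁ V₂ : Fin k → E) : Fin k → ℝ :=
  Classical.epsilon fun θ : Fin k → ℝ =>
    IsPrincipalAngles (Submodule.span ℝ (Set.range V₁)) (Submodule.span ℝ (Set.range V₂)) θ

/-- The projection metric between the spans of two orthonormal families of `k` vectors. -/
def projectionMetric {E : Type*} [NormedAddCommGroup E] [InnerProductSpace ℝ E] {k : ℕ}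
    (V₁ V₂ : Fin k → E) : ℝ :=
  Real.sqrt (∑ i, Real.sin (principalAngles V₁ V₂ i) ^ 2)

/-! ### Gradient matrices and their singular value decompositions -/

/-- The per-sample gradient matrix: row `i` is the gradient of `w ↦ L w (x i)` at `w₀`. -/
def gradientMatrix {Z : Type*} {m p : ℕ} (L : EuclideanSpace ℝ (Fin p) → Z → ℝ)
    (w₀ : EuclideanSpace ℝ (Fin p)) (x : Fin m → Z) : Matrix (Fin m) (Fin p) ℝ :=
  Matrix.of fun i j => gradient (fun w => L w (x i)) w₀ j

/-- Rescale every row `g` to `min(1, c / ‖g‖) g`. -/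
def clipRows {m p : ℕ} (c : ℝ) (G : Matrix (Fin m) (Fin p) ℝ) : Matrix (Fin m) (Fin p) ℝ :=
  Matrix.of fun i j => min 1 (c / ‖WithLp.toLp 2 (G i)‖) * G i j

/-- Clipping does nothing if no row is longer than `c`. -/
theorem clipRows_eq_self {m p : ℕ} {c : ℝ} {G : Matrix (Fin m) (Fin p) ℝ}
    (h : ∀ i, ‖WithLp.toLp 2 (G i)‖ ≤ c) : clipRows c G = G := by
  ext i j
  rcases eq_or_ne (WithLp.toLp 2 (G i)) 0 with h0 | h0
  · have hz : G i j = 0 := congrArg (fun v : EuclideanSpace ℝ (Fin p) => v j) h0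
    simp [clipRows, hz]
  · have hpos : 0 < ‖WithLp.toLp 2 (G i)‖ := norm_pos_iff.mpr h0
    have h1 : (1 : ℝ) ≤ c / ‖WithLp.toLp 2 (G i)‖ := (one_le_div hpos).mpr (h i)
    simp [clipRows, min_eq_left h1]

/-- `G = U S Wᵀ` is a (full) singular value decomposition of `G`. -/
structure IsSVD {m p : ℕ} (G : Matrix (Fin m) (Fin p) ℝ) (U : Matrix (Fin m) (Fin m) ℝ)
    (S : Matrix (Fin m) (Fin p) ℝ) (W : Matrix (Fin p) (Fin p) ℝ) : Prop where
  left_orthogonal : U ∈ Matrix.orthogonalGroup (Fin m) ℝ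
  right_orthogonal : W ∈ Matrix.orthogonalGroup (Fin p) ℝ
  off_diagonal : ∀ (i : Fin m) (j : Fin p), (i : ℕ) ≠ (j : ℕ) → S i j = 0
  diagonal_nonneg : ∀ (i : Fin m) (j : Fin p), (i : ℕ) = (j : ℕ) → 0 ≤ S i j
  diagonal_antitone : ∀ (i i' : Fin m) (j j' : Fin p), (i : ℕ) = (j : ℕ) → (i' : ℕ) = (j' : ℕ) →
    i ≤ i' → S i' j' ≤ S i j
  eq_mul : G = U * S * W.transpose

/-- `V` consists of the first `k` right singular vectors in some singular value decomposition
of `G`. -/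
def IsTopRightSingular {m p k : ℕ} (G : Matrix (Fin m) (Fin p) ℝ)
    (V : Fin k → EuclideanSpace ℝ (Fin p)) : Prop :=
  ∃ (hk : k ≤ p) (U : Matrix (Fin m) (Fin m) ℝ) (S : Matrix (Fin m) (Fin p) ℝ)
    (W : Matrix (Fin p) (Fin p) ℝ), IsSVD G U S W ∧ ∀ j i, V j i = W i (Fin.castLE hk j)

/-- The second moment matrix `A = (1/m) Xᵀ X`. -/
def secondMoment {m p : ℕ} (X : Matrix (Fin m) (Fin p) ℝ) : Matrix (Fin p) (Fin p) ℝ :=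
  (1 / (m : ℝ)) • (X.transpose * X)

theorem secondMoment_isHermitian {m p : ℕ} (X : Matrix (Fin m) (Fin p) ℝ) :
    (secondMoment X).IsHermitian := by
  simp [secondMoment, Matrix.IsHermitian]

/-- The eigenvalues of `A = (1/m) Xᵀ X` in decreasing order, with multiplicity, numbered from `0`. -/
def secondMomentEigenvalue {m p : ℕ} (X : Matrix (Fin m) (Fin p) ℝ) (i : Fin p) : ℝ :=
  (secondMoment_isHermitian X).eigenvalues₀ (Fin.cast (Fintype.card_fin p).symm i)

/-! ### The Bingham mechanism -/

/-- The uniform distribution on orthonormal `k`-frames of `ℝ^p` (`k ≤ p`), i.e. the rotation-invariant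
probability measure on the Stiefel manifold: the law of the Gram-Schmidt orthonormalization of `k`
independent vectors with the (rotation-invariant) uniform distribution on the unit ball.
For `k = 1` this is the normalized surface measure of the unit sphere. -/
def uniformFrame (p k : ℕ) : Measure (Fin k → EuclideanSpace ℝ (Fin p)) :=
  (Measure.pi fun _ : Fin k =>
    ProbabilityTheory.cond (volume : Measure (EuclideanSpace ℝ (Fin p))) (Metric.ball 0 1)).map
      (InnerProductSpace.gramSchmidtNormed ℝ)

/-- The `p × k` matrix with columns `V 0, …, V (k - 1)`. -/
def frameMatrix {p k : ℕ} (V : Fin k → EuclideanSpace ℝ (Fin p)) : Matrix (Fin p) (Fin k) ℝ :=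
  Matrix.of fun i j => V j i

/-- The matrix Bingham distribution with parameter `B`: density proportional to `exp (tr (Vᵀ B V))`
with respect to the uniform distribution on orthonormal `k`-frames. -/
def matrixBingham {p : ℕ} (k : ℕ) (B : Matrix (Fin p) (Fin p) ℝ) :
    Measure (Fin k → EuclideanSpace ℝ (Fin p)) :=
  (uniformFrame p k).tilted fun V => ((frameMatrix V).transpose * B * frameMatrix V).trace

/-- Output distribution of DPPCA on the data matrix `X` with privacy parameter `ε`:
the matrix Bingham distribution with parameter `(m ε / 2) A`, `A = (1/m) Xᵀ X`. -/
def dppca {m p : ℕ} (X : Matrix (Fin m) (Fin p) ℝ) (k : ℕ) (ε : ℝ) :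
    Measure (Fin k → EuclideanSpace ℝ (Fin p)) :=
  matrixBingham k ((m * ε / 2) • secondMoment X)

/-- A random quantity `dHat` on `(Ω, μ)` is `(ρ, η)`-close to the number `d`. -/
def IsClose {Ω : Type*} [MeasurableSpace Ω] (ρ η : ℝ) (μ : Measure Ω) (dHat : Ω → ℝ) (d : ℝ) :
    Prop :=
  1 - η ≤ μ.real {ω | |dHat ω - d| ≤ ρ}

end

/-!
For unit vectors `a`, `b` the projection metric is `√(1 - ⟪a, b⟫²)`, the sine of the angle between
the lines they span, and it satisfies the triangle inequality. Hence
`|d(V̂, V_pub) - d(V_priv, V_pub)| ≤ √(1 - ⟪V̂, V_priv⟫²)`, the public gradients drop out, and it is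
enough that `⟪V̂, V_priv⟫² ≥ 1 - ρ²` with probability at least `1 - η`.

The density of the Bingham distribution is proportional to `exp (β ⟪v, A v⟫)`, `β = m ε / 2`. In the
eigenbasis of `A` given by the singular value decomposition, `⟪v, A v⟫ ≤ λ₁ - ρ² α` wherever
`⟪v, V_priv⟫² < 1 - ρ²`, and `⟪v, A v⟫ ≥ λ₁ (1 - s²)` on the double cap `⟪v, V_priv⟫² ≥ 1 - s²`.
Comparing the two regions (`tilted_real_le_exp_div`), the former has probability at most
`exp (β (λ₁ - ρ² α) - β λ₁ (1 - s²))` divided by the uniform measure of the cap. That measure is at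
least `(s / 2) ^ p` (`le_uniformFrame_one_cap`), because the cone over the cap contains the ball of
radius `s / 2` about `V_priv / 2`. The choice `s² = ρ² α / (2 λ₁)` turns the bound into
`exp (-m ε ρ² α / 4) * (8 λ₁ / (ρ² α)) ^ (p / 2)` (`dppca_one_real_compl_cap_le`), and the lower bound
on `m` makes this at most `η`, since `ρ² = (1 - τ) (1 + τ) ≥ 1 - τ` for `τ = √(1 - ρ²)`.
-/

/-! ### The projection metric on lines -/

section Metric

variable {E : Type*} [NormedAddCommGroup E] [InnerProductSpace ℝ E]

/-- The projection metric between two lines is the sine of the angle between them. The value of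
`principalAngles` is determined here because on two lines every pair of unit vectors has the same
inner product up to sign. -/
theorem projectionMetric_fin_one {V W : Fin 1 → E} (hV : ‖V 0‖ = 1) (hW : ‖W 0‖ = 1) :
    projectionMetric V W = Real.sqrt (1 - inner ℝ (V 0) (W 0) ^ 2) := by
  have hspan : ∀ U : Fin 1 → E, Submodule.span ℝ (Set.range U) = Submodule.span ℝ {U 0} := by
    intro U; rw [Set.range_unique]; rfl
  have hunit : ∀ {v x : E}, ‖v‖ = 1 → x ∈ Submodule.span ℝ {v} → ‖x‖ = 1 →
      ∃ a : ℝ, |a| = 1 ∧ x = a • v := by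
    intro v x hv hx h1
    obtain ⟨a, rfl⟩ := Submodule.mem_span_singleton.1 hx
    exact ⟨a, by simpa [norm_smul, hv] using h1, rfl⟩
  set t : ℝ := inner ℝ (V 0) (W 0) with ht
  have habs : |t| ≤ 1 := by simpa [hV, hW] using abs_real_inner_le_norm (V 0) (W 0)
  have hex : IsPrincipalAngles (Submodule.span ℝ (Set.range V)) (Submodule.span ℝ (Set.range W))
      (principalAngles V W) := by
    refine Classical.epsilon_spec (p := fun θ : Fin 1 → ℝ => IsPrincipalAngles
      (Submodule.span ℝ (Set.range V)) (Submodule.span ℝ (Set.range W)) θ) ?_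
    obtain ⟨σ, hσ, hσt⟩ : ∃ σ : ℝ, |σ| = 1 ∧ σ * t = |t| := by
      rcases le_total 0 t with h | h
      · exact ⟨1, by simp, by rw [abs_of_nonneg h, one_mul]⟩
      · exact ⟨-1, by simp, by rw [abs_of_nonpos h]; ring⟩
    refine ⟨fun _ => Real.arccos |t|, V, fun _ => σ • W 0, fun i => ?_⟩
    obtain rfl : i = 0 := Subsingleton.elim _ _
    have hin : inner ℝ (V 0) (σ • W 0) = |t| := by rw [real_inner_smul_right, ← ht, hσt]
    refine ⟨⟨Submodule.subset_span ⟨0, rfl⟩,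
      Submodule.smul_mem _ _ (Submodule.subset_span ⟨0, rfl⟩), hV,
      by simp [norm_smul, hσ, hW], fun j hj => absurd hj (by simp)⟩, ?_,
      Real.arccos_nonneg _, Real.arccos_le_pi_div_two.2 (abs_nonneg t), ?_⟩
    · intro x hx y hy hx1 hy1 _
      rw [hspan] at hx hy
      obtain ⟨a, ha, rfl⟩ := hunit hV hx hx1
      obtain ⟨b, hb, rfl⟩ := hunit hW hy hy1
      rw [hin, real_inner_smul_left, real_inner_smul_right, ← ht]
      refine (le_abs_self _).trans ?_
      rw [abs_mul, abs_mul, ha, hb, one_mul, one_mul]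
    · rw [Real.cos_arccos (by linarith [abs_nonneg t]) habs, hin]
  obtain ⟨u, v, h⟩ := hex
  obtain ⟨⟨hu, hv, hu1, hv1, -⟩, -, -, -, hcos⟩ := h 0
  rw [hspan] at hu hv
  obtain ⟨a, ha, hua⟩ := hunit hV hu hu1
  obtain ⟨b, hb, hvb⟩ := hunit hW hv hv1
  have hcos2 : Real.cos (principalAngles V W 0) ^ 2 = t ^ 2 := by
    rw [hcos, hua, hvb, real_inner_smul_left, real_inner_smul_right, ← ht, mul_pow, mul_pow,
      ← sq_abs a, ← sq_abs b, ha, hb]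
    ring
  rw [projectionMetric, Fin.sum_univ_one, Real.sin_sq, hcos2]

theorem norm_sub_inner_smul {u : E} (hu : ‖u‖ = 1) (x : E) :
    ‖x - inner ℝ x u • u‖ = Real.sqrt (‖x‖ ^ 2 - inner ℝ x u ^ 2) := by
  have h : ‖x - inner ℝ x u • u‖ ^ 2 = ‖x‖ ^ 2 - inner ℝ x u ^ 2 := by
    rw [norm_sub_sq_real, real_inner_smul_right, norm_smul, mul_pow, hu, Real.norm_eq_abs, sq_abs]
    ring
  rw [← h, Real.sqrt_sq (norm_nonneg _)]

/-- Triangle inequality for the sine of the angle between lines: split `a` into its projection onto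
`b` and the rest, and apply the orthogonal projection along `c` to both parts. -/
theorem sqrt_one_sub_inner_sq_triangle {a b c : E} (ha : ‖a‖ = 1) (hb : ‖b‖ = 1) (hc : ‖c‖ = 1) :
    Real.sqrt (1 - inner ℝ a c ^ 2) ≤
      Real.sqrt (1 - inner ℝ a b ^ 2) + Real.sqrt (1 - inner ℝ b c ^ 2) := by
  set r : E := a - inner ℝ a b • b with hr
  have e : a - inner ℝ a c • c =
      (r - inner ℝ r c • c) + (inner ℝ a b : ℝ) • (b - inner ℝ b c • c) := by
    rw [hr, inner_sub_left, real_inner_smul_left]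
    module
  have hab : |(inner ℝ a b : ℝ)| ≤ 1 := by simpa [ha, hb] using abs_real_inner_le_norm a b
  have h1 := norm_sub_inner_smul hc a
  have h2 := norm_sub_inner_smul hb a
  have h3 := norm_sub_inner_smul hc b
  rw [ha, one_pow] at h1 h2
  rw [hb, one_pow] at h3
  have h4 : ‖r - inner ℝ r c • c‖ ≤ ‖r‖ := by
    rw [norm_sub_inner_smul hc r]
    exact Real.sqrt_le_iff.2 ⟨norm_nonneg _, by linarith [sq_nonneg (inner ℝ r c : ℝ)]⟩
  rw [← h1, ← h2, ← h3, e]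
  refine (norm_add_le _ _).trans (add_le_add h4 ?_)
  rw [norm_smul, Real.norm_eq_abs]
  exact mul_le_of_le_one_left (norm_nonneg _) hab

theorem abs_projectionMetric_sub_le {U V W : Fin 1 → E} (hU : ‖U 0‖ = 1) (hV : ‖V 0‖ = 1)
    (hW : ‖W 0‖ = 1) :
    |projectionMetric U W - projectionMetric V W| ≤ Real.sqrt (1 - inner ℝ (U 0) (V 0) ^ 2) := by
  rw [projectionMetric_fin_one hU hW, projectionMetric_fin_one hV hW]
  have h1 := sqrt_one_sub_inner_sq_triangle hU hV hW
  have h2 := sqrt_one_sub_inner_sq_triangle hV hU hW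
  rw [real_inner_comm (U 0) (V 0)] at h2
  exact abs_sub_le_iff.2 ⟨by linarith, by linarith⟩

end Metric

/-! ### The second moment matrix in the basis of right singular vectors -/

section Spectral

open Matrix

/-- The sorted eigenvalues can be read off any orthogonal diagonalization with decreasing diagonal,
because both lists are the sorted roots of the characteristic polynomial. -/
theorem Matrix.IsHermitian.eigenvalues₀_eq_of_eq_mul_diagonal {p : ℕ}
    {A W : Matrix (Fin p) (Fin p) ℝ} (hA : A.IsHermitian)
    (hW : W ∈ Matrix.orthogonalGroup (Fin p) ℝ) {d : Fin p → ℝ} (hd : Antitone d)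
    (h : A = W * Matrix.diagonal d * W.transpose) (i : Fin p) :
    hA.eigenvalues₀ (Fin.cast (Fintype.card_fin p).symm i) = d i := by
  have hc : A.charpoly = (Matrix.diagonal d).charpoly := by
    rw [h, Matrix.charpoly_mul_comm, ← Matrix.mul_assoc]
    rw [(Matrix.mem_orthogonalGroup_iff' (Fin p) ℝ).1 hW, Matrix.one_mul]
  have h2 : (Matrix.diagonal d).charpoly.roots = Multiset.map d Finset.univ.val := by
    rw [Matrix.charpoly_diagonal]
    exact Polynomial.roots_multiset_prod_X_sub_C (Finset.univ.val.map d) ▸ by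
      rw [Multiset.map_map]; rfl
  have h3 := hA.sort_roots_charpoly_eq_eigenvalues₀
  rw [hc, h2] at h3
  have h4 : List.ofFn hA.eigenvalues₀ = List.ofFn d := by
    rw [← h3]
    have : (Multiset.map RCLike.re (Multiset.map d Finset.univ.val)) = (List.ofFn d : Multiset ℝ) := by
      rw [Fin.univ_val_map, Multiset.map_coe]
      rw [List.map_ofFn]
      rfl
    rw [this]
    refine List.Perm.eq_of_sortedGE ?_ (List.sortedGE_ofFn_iff.2 hd) ?_
    · exact (Multiset.pairwise_sort _ _).sortedGE
    · exact Multiset.coe_eq_coe.1 (Multiset.sort_eq _ _)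
  have h5 := congrArg (fun l : List ℝ => l[(i : ℕ)]?) h4
  simpa [List.getElem?_ofFn] using h5

/-- A singular value decomposition `G = U S Wᵀ` diagonalizes the second moment matrix:
`(1/m) Gᵀ G = W ((1/m) Sᵀ S) Wᵀ`. -/
theorem IsSVD.exists_secondMoment_eq {m p : ℕ} {G : Matrix (Fin m) (Fin p) ℝ}
    {U : Matrix (Fin m) (Fin m) ℝ} {S : Matrix (Fin m) (Fin p) ℝ} {W : Matrix (Fin p) (Fin p) ℝ}
    (h : IsSVD G U S W) :
    ∃ d : Fin p → ℝ, Antitone d ∧ (∀ j, 0 ≤ d j) ∧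
      secondMoment G = W * Matrix.diagonal d * W.transpose := by
  have hU := (Matrix.mem_orthogonalGroup_iff' (Fin m) ℝ).1 h.left_orthogonal
  have hnn : ∀ i j, 0 ≤ S i j := fun i j => by
    by_cases hij : (i : ℕ) = j
    · exact h.diagonal_nonneg i j hij
    · rw [h.off_diagonal i j hij]
  have hdiag : S.transpose * S = Matrix.diagonal fun j => ∑ i, S i j ^ 2 := by
    ext j k
    rw [Matrix.mul_apply, Matrix.diagonal_apply]
    split_ifs with hjk
    · subst hjk; simp [sq]
    · refine Finset.sum_eq_zero fun i _ => ?_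
      by_cases hij : (i : ℕ) = j
      · have : (i : ℕ) ≠ k := fun hik => hjk (Fin.ext (hij.symm.trans hik))
        rw [h.off_diagonal i k this, mul_zero]
      · rw [Matrix.transpose_apply, h.off_diagonal i j hij, zero_mul]
  refine ⟨fun j => 1 / (m : ℝ) * ∑ i, S i j ^ 2, fun j k hjk => ?_, fun j => by positivity, ?_⟩
  · refine mul_le_mul_of_nonneg_left ?_ (by positivity)
    rcases lt_or_ge (k : ℕ) m with hk | hk
    · have hj : (j : ℕ) < m := lt_of_le_of_lt hjk hk
      rw [Finset.sum_eq_single (⟨k, hk⟩ : Fin m)]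
      · calc S ⟨k, hk⟩ k ^ 2 ≤ S ⟨j, hj⟩ j ^ 2 :=
              pow_le_pow_left₀ (hnn _ _) (h.diagonal_antitone _ _ _ _ rfl rfl hjk) 2
          _ ≤ _ := Finset.single_le_sum (f := fun i => S i j ^ 2) (fun i _ => sq_nonneg _)
              (Finset.mem_univ _)
      · intro i _ hi
        rw [h.off_diagonal i k fun hik => hi (Fin.ext hik)]
        simp
      · simp
    -- for `m ≤ k` column `k` of `S` has no diagonal entry, so it vanishes
    · rw [Finset.sum_eq_zero fun i _ => ?_]
      · exact Finset.sum_nonneg fun i _ => sq_nonneg _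
      · rw [h.off_diagonal i k (by omega)]
        simp
  · have e : G.transpose * G = W * (S.transpose * S) * W.transpose := by
      rw [h.eq_mul]
      simp only [Matrix.transpose_mul, Matrix.transpose_transpose]
      calc W * (S.transpose * U.transpose) * (U * S * W.transpose)
          = W * (S.transpose * (U.transpose * U) * S) * W.transpose := by
            simp only [Matrix.mul_assoc]
        _ = _ := by rw [hU, Matrix.mul_one]
    rw [secondMoment, e, hdiag, ← Matrix.smul_mul, ← Matrix.mul_smul, ← Matrix.diagonal_smul]
    rfl

theorem trace_frameMatrix_mul_diagonal {p : ℕ} (W : Matrix (Fin p) (Fin p) ℝ) (d : Fin p → ℝ)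
    (V : Fin 1 → EuclideanSpace ℝ (Fin p)) :
    ((frameMatrix V).transpose * (W * Matrix.diagonal d * W.transpose) * frameMatrix V).trace =
      ∑ j, d j * (W.transpose *ᵥ (V 0).ofLp) j ^ 2 := by
  have e : (frameMatrix V).transpose * (W * Matrix.diagonal d * W.transpose) * frameMatrix V =
      (W.transpose * frameMatrix V).transpose * Matrix.diagonal d * (W.transpose * frameMatrix V) := by
    simp only [Matrix.transpose_mul, Matrix.transpose_transpose, Matrix.mul_assoc]
  rw [e, Matrix.trace, Fin.sum_univ_one, Matrix.diag_apply, Matrix.mul_apply]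
  refine Finset.sum_congr rfl fun j _ => ?_
  rw [Matrix.mul_diagonal, Matrix.transpose_apply]
  have : (W.transpose * frameMatrix V) j 0 = (W.transpose *ᵥ (V 0).ofLp) j := rfl
  rw [this]; ring

theorem sum_transpose_mulVec_sq {p : ℕ} {W : Matrix (Fin p) (Fin p) ℝ}
    (hW : W ∈ Matrix.orthogonalGroup (Fin p) ℝ) (v : EuclideanSpace ℝ (Fin p)) :
    ∑ j, (W.transpose *ᵥ v.ofLp) j ^ 2 = ‖v‖ ^ 2 := by
  have hW' := (Matrix.mem_orthogonalGroup_iff (Fin p) ℝ).1 hW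
  have : (W.transpose *ᵥ v.ofLp) ⬝ᵥ (W.transpose *ᵥ v.ofLp) = v.ofLp ⬝ᵥ v.ofLp := by
    rw [Matrix.dotProduct_mulVec, Matrix.vecMul_transpose, Matrix.mulVec_mulVec, hW',
      Matrix.one_mulVec]
  rw [EuclideanSpace.norm_sq_eq]
  simpa [dotProduct, sq] using this

theorem IsTopRightSingular.norm_eq_one {m p k : ℕ} {G : Matrix (Fin m) (Fin p) ℝ}
    {V : Fin k → EuclideanSpace ℝ (Fin p)} (h : IsTopRightSingular G V) (j : Fin k) :
    ‖V j‖ = 1 := by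
  obtain ⟨hk, U, S, W, hS, hV⟩ := h
  have hW := (Matrix.mem_orthogonalGroup_iff' (Fin p) ℝ).1 hS.right_orthogonal
  have h1 := congrFun (congrFun hW (Fin.castLE hk j)) (Fin.castLE hk j)
  rw [Matrix.one_apply_eq, Matrix.mul_apply] at h1
  have h2 : ‖V j‖ ^ 2 = 1 := by
    rw [EuclideanSpace.norm_sq_eq, ← h1]
    refine Finset.sum_congr rfl fun i _ => ?_
    rw [hV, Real.norm_eq_abs, sq_abs, Matrix.transpose_apply, sq]
  exact (pow_eq_one_iff_of_nonneg (norm_nonneg _) two_ne_zero).1 h2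

/-- Rayleigh quotient bounds for `A = (1/m) Gᵀ G` at a unit vector, in terms of its component `t`
along the top right singular vector: on the orthogonal complement of that vector the quadratic form
lies between `0` and `λ₂`. -/
theorem IsTopRightSingular.secondMoment_trace_bounds {m p : ℕ} (hp : 2 ≤ p)
    {G : Matrix (Fin m) (Fin p) ℝ} {V : Fin 1 → EuclideanSpace ℝ (Fin p)}
    (h : IsTopRightSingular G V) {V' : Fin 1 → EuclideanSpace ℝ (Fin p)} (hV' : ‖V' 0‖ = 1) :
    let lam₁ := secondMomentEigenvalue G (Fin.castLE hp 0)
    let lam₂ := secondMomentEigenvalue G (Fin.castLE hp 1)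
    let q := ((frameMatrix V').transpose * secondMoment G * frameMatrix V').trace
    let t : ℝ := inner ℝ (V' 0) (V 0)
    0 ≤ lam₂ ∧ lam₁ * t ^ 2 ≤ q ∧ q ≤ lam₁ * t ^ 2 + lam₂ * (1 - t ^ 2) := by
  intro lam₁ lam₂ q t
  obtain ⟨hk, U, S, W, hS, hV⟩ := h
  obtain ⟨d, hd, hd0, hA⟩ := hS.exists_secondMoment_eq
  have hlam : ∀ i, secondMomentEigenvalue G i = d i := fun i =>
    (secondMoment_isHermitian G).eigenvalues₀_eq_of_eq_mul_diagonal hS.right_orthogonal hd hA i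
  set y := W.transpose *ᵥ (V' 0).ofLp with hy
  have hq : q = ∑ j, d j * y j ^ 2 := by
    simp only [q, hA]
    exact trace_frameMatrix_mul_diagonal W d V'
  have hsum : ∑ j, y j ^ 2 = 1 := by
    rw [sum_transpose_mulVec_sq hS.right_orthogonal, hV', one_pow]
  let i₀ : Fin p := Fin.castLE hp 0
  have ht : t = y i₀ := by
    simp only [t, hy, PiLp.inner_apply, Matrix.mulVec, dotProduct]
    refine Finset.sum_congr rfl fun i _ => ?_
    rw [hV]
    rfl
  have e1 : lam₁ = d i₀ := hlam _
  have e2 : lam₂ = d (Fin.castLE hp 1) := hlam _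
  rw [← Finset.add_sum_erase _ _ (Finset.mem_univ i₀)] at hq hsum
  refine ⟨by rw [e2]; exact hd0 _, ?_, ?_⟩
  · rw [hq, e1, ht]
    exact le_add_of_nonneg_right
      (Finset.sum_nonneg fun j _ => mul_nonneg (hd0 j) (sq_nonneg _))
  · have h1 : 1 - t ^ 2 = ∑ j ∈ Finset.univ.erase i₀, y j ^ 2 := by rw [ht]; linarith
    rw [hq, h1, e1, ht, Finset.mul_sum]
    refine add_le_add le_rfl (Finset.sum_le_sum fun j hj =>
      mul_le_mul_of_nonneg_right ?_ (sq_nonneg _))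
    rw [e2]
    refine hd (Fin.le_def.2 ?_)
    have : (j : ℕ) ≠ 0 := fun h0 => Finset.ne_of_mem_erase hj (Fin.ext h0)
    show 1 ≤ (j : ℕ)
    omega

end Spectral

/-! ### Comparison of two events under an exponential tilting -/

section Tilted

variable {Ω : Type*} [MeasurableSpace Ω]

/-- If the density exponent is at most `a` on `s` and at least `b` on `t`, then the normalizing
constant is at least `exp b * μ t`, which bounds the tilted probability of `s`. -/
theorem tilted_real_le_exp_div {μ : Measure Ω} [IsProbabilityMeasure μ] {f : Ω → ℝ} {s t : Set Ω}
    (hf : Integrable (fun x => Real.exp (f x)) μ) (hs : MeasurableSet s) (ht : MeasurableSet t)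
    {a b : ℝ} (ha : ∀ x ∈ s, f x ≤ a) (hb : ∀ x ∈ t, b ≤ f x) (hpos : 0 < μ.real t) :
    (μ.tilted f).real s ≤ Real.exp (a - b) / μ.real t := by
  have hZ : Real.exp b * μ.real t ≤ ∫ x, Real.exp (f x) ∂μ := by
    calc Real.exp b * μ.real t = ∫ x in t, Real.exp b ∂μ := by
          rw [setIntegral_const, smul_eq_mul, mul_comm]
      _ ≤ ∫ x in t, Real.exp (f x) ∂μ :=
          setIntegral_mono_on (integrable_const _).integrableOn hf.integrableOn ht
            fun x hx => Real.exp_le_exp.2 (hb x hx)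
      _ ≤ ∫ x, Real.exp (f x) ∂μ :=
          setIntegral_le_integral hf (ae_of_all _ fun x => (Real.exp_pos _).le)
  have hN : ∫ x in s, Real.exp (f x) ∂μ ≤ Real.exp a := by
    calc ∫ x in s, Real.exp (f x) ∂μ ≤ ∫ x in s, Real.exp a ∂μ :=
          setIntegral_mono_on hf.integrableOn (integrable_const _).integrableOn hs
            fun x hx => Real.exp_le_exp.2 (ha x hx)
      _ = μ.real s * Real.exp a := by rw [setIntegral_const, smul_eq_mul]
      _ ≤ Real.exp a := mul_le_of_le_one_left (Real.exp_pos _).le measureReal_le_one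
  have hbt : 0 < Real.exp b * μ.real t := mul_pos (Real.exp_pos _) hpos
  rw [measureReal_def, tilted_apply_eq_ofReal_integral' f hs, integral_div,
    ENNReal.toReal_ofReal
      (div_nonneg (integral_nonneg fun x => (Real.exp_pos _).le) (hbt.le.trans hZ)),
    Real.exp_sub, div_div]
  exact div_le_div₀ (Real.exp_pos _).le hN hbt hZ

end Tilted

/-! ### The uniform distribution on the unit sphere -/

section Frame

variable {p : ℕ}

theorem gramSchmidtNormed_fin_one {E : Type*} [NormedAddCommGroup E] [InnerProductSpace ℝ E]
    (V : Fin 1 → E) :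
    InnerProductSpace.gramSchmidtNormed ℝ V = fun _ => ‖V 0‖⁻¹ • V 0 := by
  funext i
  obtain rfl : i = 0 := Subsingleton.elim _ _
  have : InnerProductSpace.gramSchmidt ℝ V 0 = V 0 := InnerProductSpace.gramSchmidt_bot ℝ V
  simp [InnerProductSpace.gramSchmidtNormed, this]

theorem measurable_gramSchmidtNormed_fin_one :
    Measurable (InnerProductSpace.gramSchmidtNormed ℝ :
      (Fin 1 → EuclideanSpace ℝ (Fin p)) → Fin 1 → EuclideanSpace ℝ (Fin p)) := by
  have : (InnerProductSpace.gramSchmidtNormed ℝ :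
      (Fin 1 → EuclideanSpace ℝ (Fin p)) → Fin 1 → EuclideanSpace ℝ (Fin p)) =
      fun V _ => ‖V 0‖⁻¹ • V 0 := funext gramSchmidtNormed_fin_one
  rw [this]
  fun_prop

instance isProbabilityMeasure_cond_unitBall :
    IsProbabilityMeasure
      (ProbabilityTheory.cond (volume : Measure (EuclideanSpace ℝ (Fin p))) (Metric.ball 0 1)) :=
  cond_isProbabilityMeasure_of_finite (Metric.measure_ball_pos _ _ one_pos).ne'
    measure_ball_lt_top.ne

instance isProbabilityMeasure_uniformFrame_one : IsProbabilityMeasure (uniformFrame p 1) :=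
  Measure.isProbabilityMeasure_map measurable_gramSchmidtNormed_fin_one.aemeasurable

/-- `uniformFrame p 1` is the law of the direction of a uniform random point of the unit ball. -/
theorem uniformFrame_one_apply {s : Set (EuclideanSpace ℝ (Fin p))} (hs : MeasurableSet s) :
    uniformFrame p 1 {V | V 0 ∈ s} =
      ProbabilityTheory.cond (volume : Measure (EuclideanSpace ℝ (Fin p))) (Metric.ball 0 1)
        {x | ‖x‖⁻¹ • x ∈ s} := by
  have hT : MeasurableSet {V : Fin 1 → EuclideanSpace ℝ (Fin p) | V 0 ∈ s} :=
    (measurable_pi_apply 0) hs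
  have hs' : MeasurableSet {x : EuclideanSpace ℝ (Fin p) | ‖x‖⁻¹ • x ∈ s} :=
    (by fun_prop : Measurable fun x : EuclideanSpace ℝ (Fin p) => ‖x‖⁻¹ • x) hs
  rw [uniformFrame, Measure.map_apply measurable_gramSchmidtNormed_fin_one hT]
  have : InnerProductSpace.gramSchmidtNormed ℝ ⁻¹'
      {V : Fin 1 → EuclideanSpace ℝ (Fin p) | V 0 ∈ s} =
      Set.pi Set.univ fun _ => {x | ‖x‖⁻¹ • x ∈ s} := by
    ext V
    simp [gramSchmidtNormed_fin_one]
  rw [this, Measure.pi_pi, Fin.prod_univ_one]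

theorem ae_norm_eq_one_uniformFrame_one (hp : 0 < p) :
    ∀ᵐ V ∂uniformFrame p 1, ‖V 0‖ = 1 := by
  have : Nonempty (Fin p) := ⟨⟨0, hp⟩⟩
  have hs : MeasurableSet {x : EuclideanSpace ℝ (Fin p) | ¬ ‖x‖ = 1} :=
    (measurableSet_eq_fun measurable_norm measurable_const).compl
  rw [ae_iff]
  have := uniformFrame_one_apply hs
  simp only [Set.mem_ofPred_eq] at this
  rw [this, cond_apply measurableSet_ball]
  refine mul_eq_zero_of_right _ (measure_mono_null (t := {0}) ?_ (measure_singleton _))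
  rintro x ⟨-, hx⟩
  by_contra h0
  exact hx (by rw [norm_smul, norm_inv, norm_norm, inv_mul_cancel₀ (norm_ne_zero_iff.2 h0)])

/-- A ball of radius `s / 2` about `v / 2` lies in the cone of vectors whose angle to the line
through `v` has sine at most `s`. -/
theorem le_inner_normalize_sq_of_mem_ball {E : Type*} [NormedAddCommGroup E]
    [InnerProductSpace ℝ E] {v x : E} (hv : ‖v‖ = 1) {s : ℝ} (hs0 : 0 ≤ s) (hs1 : s ≤ 1)
    (hx : x ∈ Metric.ball ((1 / 2 : ℝ) • v) (s / 2)) :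
    ‖‖x‖⁻¹ • x‖ = 1 ∧ 1 - s ^ 2 ≤ inner ℝ (‖x‖⁻¹ • x) v ^ 2 := by
  rw [Metric.mem_ball, dist_eq_norm] at hx
  have h1 : ‖x - (1 / 2 : ℝ) • v‖ ^ 2 < (s / 2) ^ 2 :=
    pow_lt_pow_left₀ hx (norm_nonneg _) two_ne_zero
  rw [norm_sub_sq_real, real_inner_smul_right, norm_smul, hv] at h1
  norm_num at h1
  set a : ℝ := inner ℝ x v
  have h2 : ‖x‖ ^ 2 + (1 - s ^ 2) / 4 < a := by linarith
  have hs2 : s ^ 2 ≤ 1 := pow_le_one₀ hs0 hs1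
  have hx0 : x ≠ 0 := by
    rintro rfl
    simp only [a, inner_zero_left, norm_zero] at h2
    linarith
  have hn : 0 < ‖x‖ := norm_pos_iff.2 hx0
  refine ⟨by rw [norm_smul, norm_inv, norm_norm, inv_mul_cancel₀ hn.ne'], ?_⟩
  -- with `q = (1 - s²) / 4`, this is `4 q ‖x‖² ≤ (‖x‖² + q)² ≤ a²`
  have h3 : (1 - s ^ 2) * ‖x‖ ^ 2 ≤ a ^ 2 := by
    have : (‖x‖ ^ 2 + (1 - s ^ 2) / 4) ^ 2 ≤ a ^ 2 :=
      pow_le_pow_left₀ (by nlinarith [sq_nonneg ‖x‖]) h2.le 2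
    nlinarith [sq_nonneg (‖x‖ ^ 2 - (1 - s ^ 2) / 4)]
  rw [real_inner_smul_left, mul_pow, inv_pow, inv_mul_eq_div, le_div_iff₀ (by positivity)]
  exact h3

theorem measurableSet_unit_cap (v : EuclideanSpace ℝ (Fin p)) (r : ℝ) :
    MeasurableSet {x : EuclideanSpace ℝ (Fin p) | ‖x‖ = 1 ∧ r ≤ inner ℝ x v ^ 2} :=
  (measurableSet_eq_fun measurable_norm measurable_const).inter
    (measurableSet_le measurable_const
      ((Continuous.inner (𝕜 := ℝ) continuous_id' continuous_const).pow 2).measurable)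

/-- The double cap of vectors whose angle to the line through `v` has sine at most `s` has uniform
measure at least `(s / 2) ^ p`: the part in the unit ball of the cone over it contains a ball of
radius `s / 2`. -/
theorem le_uniformFrame_one_cap {v : EuclideanSpace ℝ (Fin p)} (hv : ‖v‖ = 1) {s : ℝ}
    (hs0 : 0 ≤ s) (hs1 : s ≤ 1) :
    (s / 2) ^ p ≤ (uniformFrame p 1).real {V | ‖V 0‖ = 1 ∧ 1 - s ^ 2 ≤ inner ℝ (V 0) v ^ 2} := by
  have hE : Nontrivial (EuclideanSpace ℝ (Fin p)) :=
    ⟨v, 0, fun h => by simp [h] at hv⟩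
  have h1 := uniformFrame_one_apply (measurableSet_unit_cap v (1 - s ^ 2))
  simp only [Set.mem_ofPred_eq] at h1
  have hsub : Metric.ball ((1 / 2 : ℝ) • v) (s / 2) ⊆ Metric.ball 0 1 ∩
      {x | ‖‖x‖⁻¹ • x‖ = 1 ∧ 1 - s ^ 2 ≤ inner ℝ (‖x‖⁻¹ • x) v ^ 2} := by
    intro x hx
    refine ⟨?_, le_inner_normalize_sq_of_mem_ball hv hs0 hs1 hx⟩
    refine Metric.ball_subset_ball' ?_ hx
    rw [dist_zero_right, norm_smul, hv]
    norm_num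
    linarith
  have hB0 : (volume (Metric.ball (0 : EuclideanSpace ℝ (Fin p)) 1)) ≠ 0 :=
    (Metric.measure_ball_pos _ _ one_pos).ne'
  have hBt : (volume (Metric.ball (0 : EuclideanSpace ℝ (Fin p)) 1)) ≠ ⊤ := measure_ball_lt_top.ne
  have h2 : ENNReal.ofReal ((s / 2) ^ p) ≤
      uniformFrame p 1 {V | ‖V 0‖ = 1 ∧ 1 - s ^ 2 ≤ inner ℝ (V 0) v ^ 2} := by
    rw [h1, cond_apply measurableSet_ball]
    calc ENNReal.ofReal ((s / 2) ^ p)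
        = (volume (Metric.ball (0 : EuclideanSpace ℝ (Fin p)) 1))⁻¹ *
            volume (Metric.ball ((1 / 2 : ℝ) • v) (s / 2)) := by
          rw [Measure.addHaar_ball _ ((1 / 2 : ℝ) • v) (by positivity), finrank_euclideanSpace_fin,
            mul_comm, mul_assoc, ENNReal.mul_inv_cancel hB0 hBt, mul_one]
      _ ≤ _ := mul_le_mul_right (measure_mono hsub) _
  exact (ENNReal.ofReal_le_iff_le_toReal (measure_ne_top _ _)).1 h2

end Frame

/-! ### Concentration of the Bingham distribution around the top eigenvector -/

section Utility

variable {m p : ℕ}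

theorem measurableSet_cap (v : EuclideanSpace ℝ (Fin p)) (r : ℝ) :
    MeasurableSet {V : Fin 1 → EuclideanSpace ℝ (Fin p) |
      ‖V 0‖ = 1 ∧ r ≤ inner ℝ (V 0) v ^ 2} :=
  have h : Measurable fun V : Fin 1 → EuclideanSpace ℝ (Fin p) => V 0 := measurable_pi_apply 0
  h (measurableSet_unit_cap v r)

theorem continuous_frameMatrix_trace (k : ℕ) (B : Matrix (Fin p) (Fin p) ℝ) :
    Continuous fun V : Fin k → EuclideanSpace ℝ (Fin p) =>
      ((frameMatrix V).transpose * B * frameMatrix V).trace := by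
  have h : Continuous fun V : Fin k → EuclideanSpace ℝ (Fin p) => frameMatrix V :=
    continuous_matrix fun i j => by
      simp only [frameMatrix, Matrix.of_apply]
      fun_prop
  exact ((h.matrix_transpose.matrix_mul continuous_const).matrix_mul h).matrix_trace

/-- Outside the double cap of half-angle sine `ρ` around the top right singular vector, DPPCA puts
mass at most `exp (-m ε ρ² α / 4) * (8 λ₁ / (ρ² α)) ^ (p / 2)`. The mechanism is also shown to be a
probability measure, which the default value `0` of `Measure.tilted` would otherwise leave open. -/
theorem dppca_one_real_compl_cap_le (hp : 2 ≤ p) {G : Matrix (Fin m) (Fin p) ℝ}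
    {V : Fin 1 → EuclideanSpace ℝ (Fin p)} (hV : IsTopRightSingular G V) {lam₁ α : ℝ}
    (hlam₁ : lam₁ = secondMomentEigenvalue G (Fin.castLE hp 0))
    (hα : α = lam₁ - secondMomentEigenvalue G (Fin.castLE hp 1)) (hgap : 0 < α)
    {ε ρ : ℝ} (hε : 0 < ε) (hρ : 0 < ρ) (hρ1 : ρ ≤ 1) :
    IsProbabilityMeasure (dppca G 1 ε) ∧
    (dppca G 1 ε).real {V' | ‖V' 0‖ = 1 ∧ 1 - ρ ^ 2 ≤ inner ℝ (V' 0) (V 0) ^ 2}ᶜ ≤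
      Real.exp (-(m * ε * ρ ^ 2 * α / 4)) * Real.exp (p / 2 * Real.log (8 * lam₁ / (ρ ^ 2 * α))) := by
  set lam₂ := secondMomentEigenvalue G (Fin.castLE hp 1) with hlam₂
  have hV1 := hV.norm_eq_one 0
  have hbd := fun V' (hV' : ‖(V' : Fin 1 → EuclideanSpace ℝ (Fin p)) 0‖ = 1) =>
    hV.secondMoment_trace_bounds hp hV'
  have h20 : 0 ≤ lam₂ := (hbd V hV1).1
  have hl : 0 < lam₁ := by linarith
  have hαl : α ≤ lam₁ := by linarith
  have hρ2 : ρ ^ 2 ≤ 1 := pow_le_one₀ hρ.le hρ1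
  set f : (Fin 1 → EuclideanSpace ℝ (Fin p)) → ℝ := fun V' =>
    ((frameMatrix V').transpose * (((m : ℝ) * ε / 2) • secondMoment G) * frameMatrix V').trace
    with hf
  have hfq : ∀ V', f V' = m * ε / 2 *
      ((frameMatrix V').transpose * secondMoment G * frameMatrix V').trace := fun V' => by
    simp only [hf, Matrix.mul_smul, Matrix.smul_mul, Matrix.trace_smul, smul_eq_mul]
  have hβ : (0 : ℝ) ≤ m * ε / 2 := by positivity
  have hin : ∀ V' : Fin 1 → EuclideanSpace ℝ (Fin p), ‖V' 0‖ = 1 →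
      (inner ℝ (V' 0) (V 0) : ℝ) ^ 2 ≤ 1 := fun V' hV' => by
    rw [sq_le_one_iff_abs_le_one]
    simpa [hV', hV1] using abs_real_inner_le_norm (V' 0) (V 0)
  have hunit := ae_norm_eq_one_uniformFrame_one (p := p) (by omega)
  have hfm : Measurable f := (continuous_frameMatrix_trace 1 _).measurable
  have hint : Integrable (fun V' => Real.exp (f V')) (uniformFrame p 1) := by
    refine Integrable.of_bound hfm.exp.aestronglyMeasurable (Real.exp (m * ε / 2 * lam₁)) ?_
    filter_upwards [hunit] with V' hV'
    rw [Real.norm_eq_abs, abs_of_pos (Real.exp_pos _), Real.exp_le_exp, hfq]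
    refine mul_le_mul_of_nonneg_left ?_ hβ
    obtain ⟨-, -, h3⟩ := hbd V' hV'
    rw [← hlam₁, ← hlam₂] at h3
    nlinarith [hin V' hV']
  have hprob : IsProbabilityMeasure (dppca G 1 ε) := isProbabilityMeasure_tilted hint
  refine ⟨hprob, ?_⟩
  set bad := {V' : Fin 1 → EuclideanSpace ℝ (Fin p) | ‖V' 0‖ = 1 ∧
    inner ℝ (V' 0) (V 0) ^ 2 < 1 - ρ ^ 2} with hbad
  have hbadm : MeasurableSet bad :=
    (measurableSet_eq_fun (measurable_pi_apply 0).norm measurable_const).inter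
      (measurableSet_lt
        ((Continuous.inner (𝕜 := ℝ) (continuous_apply 0) continuous_const).pow 2).measurable
        measurable_const)
  have hle : (dppca G 1 ε).real {V' | ‖V' 0‖ = 1 ∧ 1 - ρ ^ 2 ≤ inner ℝ (V' 0) (V 0) ^ 2}ᶜ ≤
      (dppca G 1 ε).real bad := by
    refine ENNReal.toReal_mono (measure_ne_top _ _) (measure_mono_ae ?_)
    filter_upwards [(tilted_absolutelyContinuous (uniformFrame p 1) f).ae_le hunit] with V' hV' h
    exact ⟨hV', not_le.1 fun h' => h ⟨hV', h'⟩⟩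
  refine hle.trans ?_
  -- the cap on which the exponent loses only half of the gap: `λ₁ s² = ρ² α / 2`
  set s := Real.sqrt (ρ ^ 2 * α / (2 * lam₁)) with hs
  have hx : 0 < ρ ^ 2 * α / (2 * lam₁) := by positivity
  have hs2 : s ^ 2 = ρ ^ 2 * α / (2 * lam₁) := Real.sq_sqrt hx.le
  have hspos : 0 < s := Real.sqrt_pos.2 hx
  have hs1 : s ≤ 1 := by
    rw [hs, Real.sqrt_le_one, div_le_one (by positivity)]
    nlinarith
  have hcap := le_uniformFrame_one_cap hV1 hspos.le hs1
  have hcap0 : 0 < (s / 2) ^ p := by positivity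
  have hmain := tilted_real_le_exp_div hint hbadm (measurableSet_cap (V 0) (1 - s ^ 2))
    (a := m * ε / 2 * (lam₁ - ρ ^ 2 * α)) (b := m * ε / 2 * (lam₁ * (1 - s ^ 2)))
    (fun V' hV' => by
      rw [hfq]
      refine mul_le_mul_of_nonneg_left ?_ hβ
      obtain ⟨-, -, h3⟩ := hbd V' hV'.1
      rw [← hlam₁, ← hlam₂] at h3
      have h4 : inner ℝ (V' 0) (V 0) ^ 2 < 1 - ρ ^ 2 := hV'.2
      have : lam₂ = lam₁ - α := by linarith
      rw [this] at h3
      nlinarith)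
    (fun V' hV' => by
      rw [hfq]
      refine mul_le_mul_of_nonneg_left ?_ hβ
      obtain ⟨-, h3, -⟩ := hbd V' hV'.1
      rw [← hlam₁] at h3
      exact (mul_le_mul_of_nonneg_left hV'.2 hl.le).trans h3)
    (hcap0.trans_le hcap)
  refine hmain.trans ?_
  have hexp : m * ε / 2 * (lam₁ - ρ ^ 2 * α) - m * ε / 2 * (lam₁ * (1 - s ^ 2)) =
      -(m * ε * ρ ^ 2 * α / 4) := by
    rw [hs2]
    field_simp
    ring
  have hs4 : (s / 2) ^ p = Real.exp (-(p / 2 * Real.log (8 * lam₁ / (ρ ^ 2 * α)))) := by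
    have h1 : (s / 2) ^ 2 = (8 * lam₁ / (ρ ^ 2 * α))⁻¹ := by
      rw [div_pow, hs2, inv_div]
      field_simp
      norm_num
    have h2 : Real.log (8 * lam₁ / (ρ ^ 2 * α)) = -(2 * Real.log (s / 2)) := by
      rw [← neg_eq_iff_eq_neg, ← Real.log_inv, ← h1, Real.log_pow]
      norm_num
    rw [h2, ← Real.exp_log hcap0, Real.log_pow]
    congr 1
    ring
  rw [hexp]
  calc Real.exp (-(m * ε * ρ ^ 2 * α / 4)) / _
      ≤ Real.exp (-(m * ε * ρ ^ 2 * α / 4)) / (s / 2) ^ p :=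
        div_le_div_of_nonneg_left (Real.exp_pos _).le hcap0 hcap
    _ = _ := by rw [hs4, Real.exp_neg (_ * _), div_inv_eq_mul]

/-- The utility guarantee of DPPCA for an arbitrary reference line `W`, with the privacy parameter
and the clip norm merged into one `ε`. -/
theorem isClose_projectionMetric_dppca_one (hp : 2 ≤ p) {G : Matrix (Fin m) (Fin p) ℝ}
    {V W : Fin 1 → EuclideanSpace ℝ (Fin p)} (hV : IsTopRightSingular G V) (hW : ‖W 0‖ = 1)
    {lam₁ α : ℝ} (hlam₁ : lam₁ = secondMomentEigenvalue G (Fin.castLE hp 0))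
    (hα : α = lam₁ - secondMomentEigenvalue G (Fin.castLE hp 1)) (hgap : 0 < α)
    {ε ρ η : ℝ} (hε : 0 < ε) (hρ : 0 < ρ) (hρ1 : ρ ≤ 1) (hη : 0 < η)
    (hm : p / (ε * α * (1 - Real.sqrt (1 - ρ ^ 2))) *
      (4 * (Real.log (1 / η) / p) + 2 * Real.log (8 * lam₁ / (ρ ^ 2 * α))) ≤ m) :
    IsClose ρ η (dppca G 1 ε) (fun V' => projectionMetric V' W) (projectionMetric V W) := by
  obtain ⟨hprob, hcap⟩ := dppca_one_real_compl_cap_le hp hV hlam₁ hα hgap hε hρ hρ1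
  -- for `η ≥ 1` the claim is void; below, `log (1 / η) > 0` keeps the bracket in `hm` nonnegative
  rcases le_or_gt 1 η with hη1 | hη1
  · exact (sub_nonpos.2 hη1).trans measureReal_nonneg
  have hV1 := hV.norm_eq_one 0
  set l := Real.log (8 * lam₁ / (ρ ^ 2 * α)) with hl
  set τ := Real.sqrt (1 - ρ ^ 2) with hτ
  have hρ2 : ρ ^ 2 ≤ 1 := pow_le_one₀ hρ.le hρ1
  have hτ0 : 0 ≤ τ := Real.sqrt_nonneg _
  have hτ2 : τ ^ 2 = 1 - ρ ^ 2 := Real.sq_sqrt (by linarith)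
  have hτ1 : τ < 1 := by
    by_contra h
    nlinarith [sq_pos_of_pos hρ]
  have hlam : α ≤ lam₁ := by
    have := (hV.secondMoment_trace_bounds hp hV1).1
    linarith
  have hl0 : 0 ≤ l := by
    refine Real.log_nonneg ?_
    rw [one_le_div (by positivity)]
    nlinarith
  have hp0 : (0 : ℝ) < p := by exact_mod_cast (by omega : 0 < p)
  have hlogη : 0 ≤ -Real.log η := neg_nonneg.2 (Real.log_nonpos hη.le hη1.le)
  have hexp : -Real.log η + p / 2 * l ≤ m * ε * ρ ^ 2 * α / 4 := by
    have hpos : 0 < ε * α * (1 - τ) := by have := sub_pos.2 hτ1; positivity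
    rw [one_div, Real.log_inv, div_mul_eq_mul_div, div_le_iff₀ hpos] at hm
    have e : (p : ℝ) * (4 * (-Real.log η / p) + 2 * l) = 4 * (-Real.log η + p / 2 * l) := by
      field_simp
      ring
    rw [e] at hm
    have hsum : 0 ≤ -Real.log η + p / 2 * l := by positivity
    -- multiply the bound on `m` by `1 + τ ≥ 1`
    have hρτ : ρ ^ 2 = (1 - τ) * (1 + τ) := by linear_combination hτ2
    rw [hρτ]
    nlinarith [mul_le_mul_of_nonneg_right hm (by linarith : (0 : ℝ) ≤ 1 + τ), mul_nonneg hsum hτ0]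
  have hbad : (dppca G 1 ε).real
      {V' | ‖V' 0‖ = 1 ∧ 1 - ρ ^ 2 ≤ inner ℝ (V' 0) (V 0) ^ 2}ᶜ ≤ η := by
    refine hcap.trans ?_
    rw [← Real.exp_add, ← Real.le_log_iff_exp_le hη]
    linarith
  rw [probReal_compl_eq_one_sub (measurableSet_cap (V 0) (1 - ρ ^ 2))] at hbad
  have hgood : {V' | ‖V' 0‖ = 1 ∧ 1 - ρ ^ 2 ≤ inner ℝ (V' 0) (V 0) ^ 2} ⊆
      {V' | |projectionMetric V' W - projectionMetric V W| ≤ ρ} := by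
    rintro V' ⟨hV', h⟩
    refine (abs_projectionMetric_sub_le hV' hV1 hW).trans ?_
    rw [Real.sqrt_le_left hρ.le]
    linarith
  have := measureReal_mono (μ := dppca G 1 ε) hgood
  unfold IsClose
  linarith

end Utility

theorem theorem3 {Z : Type*} {p m n : ℕ} (hp : 2 ≤ p)
    (L : EuclideanSpace ℝ (Fin p) → Z → ℝ) (w₀ : EuclideanSpace ℝ (Fin p))
    (xPriv : Fin m → Z) (xPub : Fin n → Z)
    (hPriv : ∀ i, DifferentiableAt ℝ (fun w => L w (xPriv i)) w₀)
    (hPub : ∀ i, DifferentiableAt ℝ (fun w => L w (xPub i)) w₀)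
    (c ε ρ η : ℝ) (hc : 0 < c) (hε : 0 < ε) (hρ : 0 < ρ) (hρ1 : ρ ≤ 1) (hη : 0 < η)
    -- the clipped private gradient matrix
    (G : Matrix (Fin m) (Fin p) ℝ) (hG : G = clipRows c (gradientMatrix L w₀ xPriv))
    -- the top eigenvalue and the eigengap of `(1/m) Gᵀ G`
    (lam₁ α : ℝ) (hlam₁ : lam₁ = secondMomentEigenvalue G ⟨0, by omega⟩)
    (hα : α = lam₁ - secondMomentEigenvalue G ⟨1, by omega⟩) (hgap : 0 < α)
    (hm : (m : ℝ) > p * c ^ 2 / (ε * α * (1 - Real.sqrt (1 - ρ ^ 2))) *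
      (4 * (Real.log (1 / η) / p) + 2 * Real.log (8 * lam₁ / (ρ ^ 2 * α))))
    -- the subspaces of the non-private distance
    (VPriv VPub : Fin 1 → EuclideanSpace ℝ (Fin p))
    (hVPriv : IsTopRightSingular G VPriv)
    (hVPub : IsTopRightSingular (gradientMatrix L w₀ xPub) VPub) :
    IsClose ρ η (dppca G 1 (ε / c ^ 2)) (fun VHat => projectionMetric VHat VPub)
        (projectionMetric VPriv VPub) ∧
      (1 ≤ c → IsClose ρ η (dppca G 1 ε) (fun VHat => projectionMetric VHat VPub)
        (projectionMetric VPriv VPub)) := by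
  set b := 4 * (Real.log (1 / η) / p) + 2 * Real.log (8 * lam₁ / (ρ ^ 2 * α)) with hb
  set κ := ε * α * (1 - Real.sqrt (1 - ρ ^ 2)) with hκ
  have hsqrt : Real.sqrt (1 - ρ ^ 2) ≤ 1 := Real.sqrt_le_one.2 (by nlinarith)
  have hκ0 : 0 ≤ κ := by have := sub_nonneg.2 hsqrt; positivity
  have hone := hVPub.norm_eq_one 0
  refine ⟨isClose_projectionMetric_dppca_one hp hVPriv hone hlam₁ hα hgap (by positivity) hρ hρ1 hη
    (hm.le.trans' (le_of_eq ?_)), fun hc1 =>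
    isClose_projectionMetric_dppca_one hp hVPriv hone hlam₁ hα hgap hε hρ hρ1 hη ?_⟩
  · rw [← hb]
    congr 1
    rw [hκ, div_mul_eq_mul_div, div_mul_eq_mul_div, div_div_eq_mul_div]
  · rw [← hb, ← hκ]
    rcases le_or_gt 0 b with hb0 | hb0
    · refine hm.le.trans' (mul_le_mul_of_nonneg_right ?_ hb0)
      exact div_le_div_of_nonneg_right
        (le_mul_of_one_le_right (Nat.cast_nonneg p) (one_le_pow₀ hc1)) hκ0
    -- a negative bracket makes the requirement on `m` void
    · exact (mul_nonpos_of_nonneg_of_nonpos (by positivity) hb0.le).trans (Nat.cast_nonneg m)
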